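/- **Conventions.** All maps are continuous, $I=[0,1]$, and $\alpha*\beta$ means "first $\alpha$, then $\beta$". A map $p:E\to X$ has - *path lifting* (pl) if for every path $\alpha:I\to X$ and every $e\in p^{-1}(\alpha(0))$ there is a path $\tilde\alpha:I\to E$ with $\tilde\alpha(0)=e$ and $p\circ\tilde\alpha=\alpha$; - *unique path lifting* (upl) if any two paths $\tilde\alpha,\tilde\beta$ in $E$ with $p\circ\tilde\alpha=p\circ\tilde\beta$ and $\tilde\alpha(0)=\tilde\beta(0)$ are equal; - *unique lifting* (ul) if for every connected, locally path connected pointed space $(Y,y)$, every $f:(Y,y)\to(X,b)$ and every $e\in p^{-1}(b)$ with $\pi_1(f)\pi_1(Y,y)\subseteq\pi_1(p)\pi_1(E,e)$ there is a unique $\tilde f:(Y,y)\to(E,e)$ with $p\circ\tilde f=f$. $p:E\to X$ is a *covering map* if $E$ is path connected and every point of $X$ has an evenly covered open neighbourhood; a *semicovering map* if $E$ is path connected and $p$ is a local homeomorphism with pl and upl; a *generalized covering map* if $E$ is path connected and $p$ has ul; a *fibration* if it has the homotopy lifting property with respect to every space. For a family $\Sigma$ of subgroups of a group $G$, the *subgroup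 topology* determined by $\Sigma$ is the topology generated by all left cosets of members of $\Sigma$. On $\pi_1(X,x_0)$ consider the subgroup topologies determined by the following families. - $\pi_1^{Span}(X,x_0)$: all Spanier subgroups $\pi(\mathcal U,x_0)$, for $\mathcal U$ an open cover of $X$. Here $\pi(\mathcal U,x_0)$ is the normal subgroup generated by the classes $[\alpha*\beta*\alpha^{-1}]$, with $\alpha$ a path from $x_0$ and $\beta$ a loop at $\alpha(1)$ lying in some $U\in\mathcal U$. - $\pi_1^{pSpan}(X,x_0)$: all path Spanier subgroups $\tilde\pi(\mathcal V,x_0)$, for $\mathcal V=\{V_\alpha\}$ a choice of an open neighbourhood $V_\alpha$ of $\alpha(1)$ for each path $\alpha$ from $x_0$. Here $\tilde\pi(\mathcal V,x_0)$ is the subgroup generated by the classes $[\alpha*\beta*\alpha^{-1}]$ with $\beta$ a loop at $\alpha(1)$ in $V_\alpha$. - $\pi_1^{gcov}(X,x_0)$: all generalized covering subgroups, that is, the subgroups $\pi_1(q)\pi_1(E,e)$ for $q:(E,e)\to(X,x_0)$ a generalized covering map. - $\pi_1^{H}(X,x_0)$, for a subgroup $H\le\pi_1(X,x_0)$: all subgroups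 containing $H$. For a topology $\tau$ on $\pi_1(X,x_0)$, a map $p:(\tilde X,\tilde x_0)\to(X,x_0)$ is a *$\pi_1^\tau$-covering map* if $\tilde X$ is path connected, $p$ has pl, and $\pi_1(p)\pi_1(\tilde X,\tilde x_0)$ is open in $\pi_1^\tau(X,x_0)$. **Theorem 3.7.** Let $X$ be a path connected space and $p:(\tilde X,\tilde x_0)\to(X,x_0)$ a continuous map. (i) If $p$ is a covering map, then $p$ is a $\pi_1^{Span}$-covering map. Conversely, suppose that $X$ and $\tilde X$ are locally path connected. If $p$ is a $\pi_1^{Span}$-covering map with the unique lifting property, then $p$ is a covering map. (ii) If $p$ is a semicovering map, then $p$ is a $\pi_1^{pSpan}$-covering map. Conversely, suppose that $X$ and $\tilde X$ are locally path connected. If $p$ is a $\pi_1^{pSpan}$-covering map with the unique lifting property, then $p$ is a semicovering map. (iii) If $p$ is a generalized covering map, then $p$ is a $\pi_1^{gcov}$-covering map. (iv) If $\tilde X$ is path connected and $p$ is a fibration, then $p$ is a $\pi_1^{\pi^{fib}(X,x_0)}$-covering map, where $\pi^{fib}(X,x_0)$ is the intersection of the subgroups $\pi_1(q)\pi_1(E,e_0)$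 over all fibrations $q:(E,e_0)\to(X,x_0)$. -/

import Mathlib

open scoped unitInterval

universe u

namespace Pi1Covering

/-! ### Lifting properties -/

section Lifting

variable {E X : Type u} [TopologicalSpace E] [TopologicalSpace X]

/-- Path lifting property: every path in `X` lifts to a path in `E` that starts at any prescribed
point over the starting point of the path. -/
def HasPathLifting (p : C(E, X)) : Prop :=
  ∀ (α : C(I, X)) (e : E), p e = α 0 → ∃ α' : C(I, E), α' 0 = e ∧ p.comp α' = α

/-- Unique path lifting property: two paths in `E` with the same starting point and the same
projection to `X` are equal. -/
def HasUniquePathLifting (p : C(E, X)) : Prop :=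
  ∀ α' β' : C(I, E), p.comp α' = p.comp β' → α' 0 = β' 0 → α' = β'

/-- The image `π₁(p)(π₁(E, e))`, a subgroup of `π₁(X, x)`, where `p e = x`. -/
noncomputable def imageSubgroup (p : C(E, X)) {e : E} {x : X} (h : p e = x) :
    Subgroup (FundamentalGroup X x) :=
  (FundamentalGroup.mapOfEq p h).range

/-- Unique lifting property: for every connected, locally path connected space `(Y, y)`, every
continuous `f : (Y, y) → (X, b)` and every `e` over `b` such that
`π₁(f)(π₁(Y, y)) ⊆ π₁(p)(π₁(E, e))`, there is a unique continuous lift `(Y, y) → (E, e)` of `f`. -/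
def HasUniqueLifting (p : C(E, X)) : Prop :=
  ∀ (Y : Type u) [TopologicalSpace Y] [ConnectedSpace Y] [LocallyPathConnectedSpace Y]
    (y : Y) (f : C(Y, X)) (b : X) (e : E) (hf : f y = b) (he : p e = b),
    imageSubgroup f hf ≤ imageSubgroup p he →
      ∃! f' : C(Y, E), f' y = e ∧ p.comp f' = f

/-! ### Covering maps and their generalizations -/

/-- A covering map; the total space is required to be path connected. -/
structure IsCovering (p : C(E, X)) : Prop where
  pathConnected : PathConnectedSpace E
  isCoveringMap : IsCoveringMap p

/-- A semicovering map: a local homeomorphism with path lifting and unique path lifting; the total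
space is required to be path connected. -/
structure IsSemicovering (p : C(E, X)) : Prop where
  pathConnected : PathConnectedSpace E
  isLocalHomeomorph : IsLocalHomeomorph p
  pathLifting : HasPathLifting p
  uniquePathLifting : HasUniquePathLifting p

/-- A generalized covering map: a continuous map with the unique lifting property; the total space
is required to be path connected. -/
structure IsGeneralizedCovering (p : C(E, X)) : Prop where
  pathConnected : PathConnectedSpace E
  uniqueLifting : HasUniqueLifting p

/-- A (Hurewicz) fibration: a map with the homotopy lifting property for every space. -/
def IsFibration (p : C(E, X)) : Prop :=
  ∀ (Y : Type u) [TopologicalSpace Y] (f : C(Y, E)) (F : C(Y × I, X)),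
    (∀ y, F (y, 0) = p (f y)) →
      ∃ F' : C(Y × I, E), (∀ y, F' (y, 0) = f y) ∧ p.comp F' = F

end Lifting

/-! ### Topologies on the fundamental group -/

section Topologies

variable {X : Type u} [TopologicalSpace X]

/-- The left coset of `H` by `g` with respect to concatenation of loops (first `g`, then an element
of `H`). In Mathlib `a * b` in `FundamentalGroup X x` is "first `b`, then `a`", hence the explicit
concatenation here. -/
noncomputable def leftCoset {x₀ : X} (g : FundamentalGroup X x₀) (H : Subgroup (FundamentalGroup X x₀)) :
    Set (FundamentalGroup X x₀) :=
  {k | ∃ h ∈ H, k = FundamentalGroup.fromPath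
    (Path.Homotopic.Quotient.trans (FundamentalGroup.toPath g) (FundamentalGroup.toPath h))}

/-- The subgroup topology on `π₁(X, x₀)` determined by a family `S` of subgroups: it is generated by
the left cosets of the members of `S` (which form a basis if `S` is a neighbourhood family). -/
@[reducible] noncomputable def subgroupTopology {x₀ : X} (S : Set (Subgroup (FundamentalGroup X x₀))) :
    TopologicalSpace (FundamentalGroup X x₀) :=
  TopologicalSpace.generateFrom {C | ∃ g : FundamentalGroup X x₀, ∃ H ∈ S, C = leftCoset g H}

/-- The class of the lollipop `α * β * α⁻¹`, where `α` is a path from `x₀` and `β` is a loop at its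
endpoint. -/
noncomputable def lollipop {x₀ y : X} (α : Path x₀ y) (β : Path y y) : FundamentalGroup X x₀ :=
  FundamentalGroup.fromPath (Path.Homotopic.Quotient.mk ((α.trans β).trans α.symm))

/-- `𝒰` is an open cover of `X`. -/
def IsOpenCover (𝒰 : Set (Set X)) : Prop :=
  (∀ U ∈ 𝒰, IsOpen U) ∧ ⋃₀ 𝒰 = Set.univ

/-- The Spanier subgroup `π(𝒰, x₀)`: the normal subgroup generated by the lollipops `α * β * α⁻¹`
with `β` a loop in some member of `𝒰`. -/
noncomputable def spanierSubgroup (x₀ : X) (𝒰 : Set (Set X)) : Subgroup (FundamentalGroup X x₀) :=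
  Subgroup.normalClosure
    {g | ∃ (y : X) (α : Path x₀ y) (β : Path y y), ∃ U ∈ 𝒰, Set.range β ⊆ U ∧ g = lollipop α β}

/-- A path open cover: an open neighbourhood `V α` of the endpoint of `α` for each path `α` starting
at `x₀`. -/
def IsPathOpenCover (x₀ : X) (V : ∀ y : X, Path x₀ y → Set X) : Prop :=
  ∀ (y : X) (α : Path x₀ y), IsOpen (V y α) ∧ y ∈ V y α

/-- The path Spanier subgroup: the subgroup generated by the lollipops `α * β * α⁻¹` with `β` a loop
in `V α`. -/
noncomputable def pathSpanierSubgroup (x₀ : X) (V : ∀ y : X, Path x₀ y → Set X) :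
    Subgroup (FundamentalGroup X x₀) :=
  Subgroup.closure
    {g | ∃ (y : X) (α : Path x₀ y) (β : Path y y), Set.range β ⊆ V y α ∧ g = lollipop α β}

/-- The Spanier topology on `π₁(X, x₀)`. -/
@[reducible] noncomputable def spanierTopology (x₀ : X) : TopologicalSpace (FundamentalGroup X x₀) :=
  subgroupTopology {H | ∃ 𝒰 : Set (Set X), IsOpenCover 𝒰 ∧ H = spanierSubgroup x₀ 𝒰}

/-- The path Spanier topology on `π₁(X, x₀)`. -/
@[reducible] noncomputable def pathSpanierTopology (x₀ : X) : TopologicalSpace (FundamentalGroup X x₀) :=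
  subgroupTopology
    {H | ∃ V : ∀ y : X, Path x₀ y → Set X, IsPathOpenCover x₀ V ∧ H = pathSpanierSubgroup x₀ V}

/-- `H` is a generalized covering subgroup: the image of `π₁(q)` for some generalized covering map
`q : (E, e) → (X, x₀)`. -/
def IsGeneralizedCoveringSubgroup {x₀ : X} (H : Subgroup (FundamentalGroup X x₀)) : Prop :=
  ∃ (E : Type u) (_ : TopologicalSpace E) (q : C(E, X)) (e : E) (h : q e = x₀),
    IsGeneralizedCovering q ∧ H = imageSubgroup q h

/-- The generalized covering topology on `π₁(X, x₀)`. -/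
@[reducible] noncomputable def gcovTopology (x₀ : X) : TopologicalSpace (FundamentalGroup X x₀) :=
  subgroupTopology {H | IsGeneralizedCoveringSubgroup H}

/-- `π^{fib}(X, x₀)`: the intersection of the images of `π₁(q)` over all fibrations
`q : (E, e) → (X, x₀)`. -/
noncomputable def fibSubgroup (x₀ : X) : Subgroup (FundamentalGroup X x₀) :=
  sInf {H | ∃ (E : Type u) (_ : TopologicalSpace E) (q : C(E, X)) (e : E) (h : q e = x₀),
    IsFibration q ∧ H = imageSubgroup q h}

/-- The topology `π₁^H(X, x₀)`: the subgroup topology determined by all subgroups containing `H`. -/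
@[reducible] noncomputable def overgroupTopology {x₀ : X} (H : Subgroup (FundamentalGroup X x₀)) :
    TopologicalSpace (FundamentalGroup X x₀) :=
  subgroupTopology {K | H ≤ K}

end Topologies

/-- `p : (E, e₀) → (X, x₀)` is a `π₁^τ`-covering map, for a topology `τ` on `π₁(X, x₀)`.
Continuity is part of the type of `p`. -/
structure IsPi1CoveringMap {E X : Type u} [TopologicalSpace E] [TopologicalSpace X]
    (p : C(E, X)) {e₀ : E} {x₀ : X} (h : p e₀ = x₀)
    (τ : TopologicalSpace (FundamentalGroup X x₀)) : Prop where
  pathConnected : PathConnectedSpace E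
  pathLifting : HasPathLifting p
  isOpen_image : @IsOpen _ τ (imageSubgroup p h : Set (FundamentalGroup X x₀))

end Pi1Covering

/-! A subgroup containing a member of the family is open, being a union of its cosets. So each
forward half asks for a member inside `imageSubgroup p h`. For generalized coverings it is that
group itself; for fibrations, the group contains the intersection defining `fibSubgroup`. For
coverings and semicoverings, lift the stem of a lollipop by path lifting and its loop by a local
section of `p`: the lollipop is then the image of a loop in `E`.

Conversely, Spanier and path Spanier subgroups are directed downwards, so an open subgroup contains
one (`exists_le_of_isOpen_subgroupTopology`). Changing base point along a path in `E`, small loops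
at `p e` lie in the image of `π₁(E, e)`, and unique lifting lifts the inclusion of a path connected
open `V` to a section (`exists_section`) with open range (`isOpen_range_section`). For an open
cover, one `V` serves all points over it, giving even covering; for a path open cover, `V` depends
on `e`, giving only a local homeomorphism. -/

namespace Pi1Covering

/-! ### Images of fundamental groups and change of base point -/

section Subgroups

variable {E X : Type u} [TopologicalSpace E] [TopologicalSpace X]

theorem mem_imageSubgroup {p : C(E, X)} {e : E} {x : X} {h : p e = x} {g : FundamentalGroup X x} :
    g ∈ imageSubgroup p h ↔ ∃ (γ : Path e e) (β : Path x x), (∀ t, β t = p (γ t)) ∧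
      g = FundamentalGroup.fromPath (Path.Homotopic.Quotient.mk β) := by
  subst h
  constructor
  · rintro ⟨a, rfl⟩
    obtain ⟨γ, rfl⟩ := Path.Homotopic.Quotient.mk_surjective a
    refine ⟨γ, γ.map p.continuous, fun t => rfl, ?_⟩
    rw [FundamentalGroup.mapOfEq_apply]
    rfl
  · rintro ⟨γ, β, hβ, rfl⟩
    refine ⟨FundamentalGroup.fromPath (Path.Homotopic.Quotient.mk γ), ?_⟩
    rw [FundamentalGroup.mapOfEq_apply]
    have : β = γ.map p.continuous := by ext t; exact hβ t
    rw [this]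
    rfl

theorem lollipop_mem_imageSubgroup {p : C(E, X)} {e₀ e : E} {x₀ y : X} (h : p e₀ = x₀)
    {α : Path x₀ y} {β : Path y y} (γ : Path e₀ e) (δ : Path e e)
    (hα : ∀ t, α t = p (γ t)) (hβ : ∀ t, β t = p (δ t)) :
    lollipop α β ∈ imageSubgroup p h := by
  refine mem_imageSubgroup.2 ⟨(γ.trans δ).trans γ.symm, _, fun t => ?_, rfl⟩
  simp only [Path.trans_apply, Path.symm_apply]
  split_ifs <;> simp [hα, hβ]

/-- Change of base point: if `δ` is a loop in `E` realizing the lollipop, then `γ⁻¹ * δ * γ`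
realizes `α⁻¹ * (α * β * α⁻¹) * α`, which is homotopic to `β`. -/
theorem mk_mem_imageSubgroup_of_lollipop_mem {p : C(E, X)} {e₀ e : E} {x₀ y : X}
    {h : p e₀ = x₀} (he : p e = y) {α : Path x₀ y} {β : Path y y} (γ : Path e₀ e)
    (hα : ∀ t, α t = p (γ t)) (hm : lollipop α β ∈ imageSubgroup p h) :
    FundamentalGroup.fromPath (Path.Homotopic.Quotient.mk β) ∈ imageSubgroup p he := by
  obtain ⟨δ, ε, hε, hl⟩ := mem_imageSubgroup.1 hm
  refine mem_imageSubgroup.2 ⟨(γ.symm.trans δ).trans γ, (α.symm.trans ε).trans α, fun t => ?_, ?_⟩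
  · simp only [Path.trans_apply, Path.symm_apply]
    split_ifs <;> simp [hα, hε]
  · change Path.Homotopic.Quotient.mk β = _
    change Path.Homotopic.Quotient.mk _ = Path.Homotopic.Quotient.mk ε at hl
    change _ = Path.Homotopic.Quotient.mk _
    simp only [Path.Homotopic.Quotient.mk_trans, Path.Homotopic.Quotient.mk_symm, ← hl]
    simp only [Path.Homotopic.Quotient.trans_assoc, Path.Homotopic.Quotient.symm_trans,
      Path.Homotopic.Quotient.trans_refl]
    simp only [← Path.Homotopic.Quotient.trans_assoc, Path.Homotopic.Quotient.symm_trans,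
      Path.Homotopic.Quotient.refl_trans]

/-- The lifting criterion is automatic for a map that already has a lift; this turns unique lifting
into uniqueness of lifts. -/
theorem imageSubgroup_comp_le {Y : Type u} [TopologicalSpace Y] {p : C(E, X)} {f : C(Y, E)}
    {y : Y} {e : E} {b : X} (hf : f y = e) (he : p e = b) (hfe : p.comp f y = b) :
    imageSubgroup (p.comp f) hfe ≤ imageSubgroup p he := by
  intro g hg
  obtain ⟨γ, β, hβ, rfl⟩ := mem_imageSubgroup.1 hg
  exact mem_imageSubgroup.2 ⟨(γ.map f.continuous).cast hf.symm hf.symm, β, hβ, rfl⟩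

end Subgroups

/-! ### Open subgroups in subgroup topologies -/

section Topologies

variable {X : Type u} [TopologicalSpace X] {x₀ : X}

/-- Multiplication in `FundamentalGroup` reverses concatenation, so left cosets for concatenation
are right cosets for `*`. -/
theorem mem_leftCoset {g k : FundamentalGroup X x₀} {H : Subgroup (FundamentalGroup X x₀)} :
    k ∈ leftCoset g H ↔ k * g⁻¹ ∈ H := by
  constructor
  · rintro ⟨h, hh, rfl⟩
    change h * g * g⁻¹ ∈ H
    rwa [mul_inv_cancel_right]
  · intro hk
    exact ⟨_, hk, (inv_mul_cancel_right k g).symm⟩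

theorem isOpen_of_le_subgroupTopology {S : Set (Subgroup (FundamentalGroup X x₀))}
    {K H : Subgroup (FundamentalGroup X x₀)} (hK : K ∈ S) (hKH : K ≤ H) :
    @IsOpen _ (subgroupTopology S) (H : Set (FundamentalGroup X x₀)) := by
  let := subgroupTopology S
  have : (H : Set (FundamentalGroup X x₀)) = ⋃ g ∈ H, leftCoset g K := by
    ext k
    simp only [SetLike.mem_coe, Set.mem_iUnion, mem_leftCoset, exists_prop]
    refine ⟨fun hk => ⟨k, hk, by rw [mul_inv_cancel]; exact K.one_mem⟩, ?_⟩
    rintro ⟨g, hg, hk⟩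
    rw [← inv_mul_cancel_right k g]
    exact H.mul_mem (hKH hk) hg
  rw [this]
  exact isOpen_biUnion fun g _ => TopologicalSpace.isOpen_generateFrom_of_mem ⟨g, K, hK, rfl⟩

theorem exists_le_of_isOpen_subgroupTopology {S : Set (Subgroup (FundamentalGroup X x₀))}
    (hne : S.Nonempty) (hdir : ∀ H ∈ S, ∀ K ∈ S, ∃ L ∈ S, L ≤ H ⊓ K)
    {H : Subgroup (FundamentalGroup X x₀)}
    (hH : @IsOpen _ (subgroupTopology S) (H : Set (FundamentalGroup X x₀))) :
    ∃ K ∈ S, K ≤ H := by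
  have key : ∀ C : Set (FundamentalGroup X x₀), @IsOpen _ (subgroupTopology S) C →
      ∀ g ∈ C, ∃ K ∈ S, leftCoset g K ⊆ C := by
    intro C hC
    induction hC with
    | basic s hs =>
      obtain ⟨g', K, hK, rfl⟩ := hs
      intro g hg
      -- A coset of `K` is the coset of each of its elements, so `K` itself works.
      refine ⟨K, hK, fun k hk => mem_leftCoset.2 ?_⟩
      rw [← inv_mul_cancel_right k g, mul_assoc]
      exact K.mul_mem (mem_leftCoset.1 hk) (mem_leftCoset.1 hg)
    | univ =>
      intro g _
      obtain ⟨K, hK⟩ := hne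
      exact ⟨K, hK, Set.subset_univ _⟩
    | inter s t _ _ ihs iht =>
      intro g hg
      obtain ⟨K, hK, hKs⟩ := ihs g hg.1
      obtain ⟨L, hL, hLt⟩ := iht g hg.2
      obtain ⟨M, hM, hMKL⟩ := hdir K hK L hL
      refine ⟨M, hM, fun k hk => ⟨hKs ?_, hLt ?_⟩⟩
      · exact mem_leftCoset.2 (hMKL (mem_leftCoset.1 hk)).1
      · exact mem_leftCoset.2 (hMKL (mem_leftCoset.1 hk)).2
    | sUnion T _ ih =>
      rintro g ⟨t, ht, hg⟩
      obtain ⟨K, hK, hKt⟩ := ih t ht g hg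
      exact ⟨K, hK, hKt.trans (Set.subset_sUnion_of_mem ht)⟩
  obtain ⟨K, hK, hKH⟩ := key _ hH 1 H.one_mem
  exact ⟨K, hK, fun k hk => hKH (mem_leftCoset.2 (by rwa [inv_one, mul_one]))⟩

theorem spanierSubgroup_mono {𝒰 𝒱 : Set (Set X)} (h : ∀ U ∈ 𝒰, ∃ V ∈ 𝒱, U ⊆ V) :
    spanierSubgroup x₀ 𝒰 ≤ spanierSubgroup x₀ 𝒱 := by
  refine Subgroup.normalClosure_mono ?_
  rintro _ ⟨y, α, β, U, hU, hβ, rfl⟩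
  obtain ⟨V, hV, hUV⟩ := h U hU
  exact ⟨y, α, β, V, hV, hβ.trans hUV, rfl⟩

theorem exists_spanierSubgroup_le {H : Subgroup (FundamentalGroup X x₀)}
    (hH : @IsOpen _ (spanierTopology x₀) (H : Set (FundamentalGroup X x₀))) :
    ∃ 𝒰 : Set (Set X), IsOpenCover 𝒰 ∧ spanierSubgroup x₀ 𝒰 ≤ H := by
  suffices hex : ∃ K ∈ {H | ∃ 𝒰 : Set (Set X), IsOpenCover 𝒰 ∧ H = spanierSubgroup x₀ 𝒰},
      K ≤ H by
    obtain ⟨_, ⟨𝒰, h𝒰, rfl⟩, hle⟩ := hex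
    exact ⟨𝒰, h𝒰, hle⟩
  refine exists_le_of_isOpen_subgroupTopology
    (S := {H | ∃ 𝒰 : Set (Set X), IsOpenCover 𝒰 ∧ H = spanierSubgroup x₀ 𝒰})
    ⟨_, {Set.univ}, ⟨by simp, by simp⟩, rfl⟩ ?_ hH
  · rintro _ ⟨𝒰, h𝒰, rfl⟩ _ ⟨𝒱, h𝒱, rfl⟩
    refine ⟨_, ⟨Set.image2 (· ∩ ·) 𝒰 𝒱, ⟨?_, ?_⟩, rfl⟩, le_inf ?_ ?_⟩
    · rintro _ ⟨U, hU, V, hV, rfl⟩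
      exact (h𝒰.1 U hU).inter (h𝒱.1 V hV)
    · refine Set.eq_univ_of_forall fun x => ?_
      obtain ⟨U, hU, hxU⟩ := h𝒰.2.symm ▸ Set.mem_univ x
      obtain ⟨V, hV, hxV⟩ := h𝒱.2.symm ▸ Set.mem_univ x
      exact ⟨U ∩ V, ⟨U, hU, V, hV, rfl⟩, hxU, hxV⟩
    · apply spanierSubgroup_mono
      rintro _ ⟨U, hU, V, hV, rfl⟩
      exact ⟨U, hU, Set.inter_subset_left⟩
    · apply spanierSubgroup_mono
      rintro _ ⟨U, hU, V, hV, rfl⟩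
      exact ⟨V, hV, Set.inter_subset_right⟩

theorem pathSpanierSubgroup_mono {V W : ∀ y : X, Path x₀ y → Set X}
    (h : ∀ y α, V y α ⊆ W y α) : pathSpanierSubgroup x₀ V ≤ pathSpanierSubgroup x₀ W := by
  refine Subgroup.closure_mono ?_
  rintro _ ⟨y, α, β, hβ, rfl⟩
  exact ⟨y, α, β, hβ.trans (h y α), rfl⟩

theorem exists_pathSpanierSubgroup_le {H : Subgroup (FundamentalGroup X x₀)}
    (hH : @IsOpen _ (pathSpanierTopology x₀) (H : Set (FundamentalGroup X x₀))) :
    ∃ V : ∀ y : X, Path x₀ y → Set X, IsPathOpenCover x₀ V ∧ pathSpanierSubgroup x₀ V ≤ H := by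
  suffices hex : ∃ K ∈ {H | ∃ V : ∀ y : X, Path x₀ y → Set X,
      IsPathOpenCover x₀ V ∧ H = pathSpanierSubgroup x₀ V}, K ≤ H by
    obtain ⟨_, ⟨V, hV, rfl⟩, hle⟩ := hex
    exact ⟨V, hV, hle⟩
  refine exists_le_of_isOpen_subgroupTopology
    (S := {H | ∃ V : ∀ y : X, Path x₀ y → Set X,
      IsPathOpenCover x₀ V ∧ H = pathSpanierSubgroup x₀ V})
    ⟨_, fun _ _ => Set.univ, fun _ _ => ⟨isOpen_univ, trivial⟩, rfl⟩ ?_ hH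
  · rintro _ ⟨V, hV, rfl⟩ _ ⟨W, hW, rfl⟩
    exact ⟨_, ⟨fun y α => V y α ∩ W y α,
      fun y α => ⟨(hV y α).1.inter (hW y α).1, (hV y α).2, (hW y α).2⟩, rfl⟩,
      le_inf (pathSpanierSubgroup_mono fun _ _ => Set.inter_subset_left)
        (pathSpanierSubgroup_mono fun _ _ => Set.inter_subset_right)⟩

end Topologies

/-! ### Path lifting from unique lifting, fibrations and coverings -/

section Lifting

variable {E X : Type u} [TopologicalSpace E] [TopologicalSpace X] {p : C(E, X)}

theorem HasPathLifting.exists_path (hp : HasPathLifting p) {e₀ : E} {x₀ y : X} (h : p e₀ = x₀)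
    (α : Path x₀ y) : ∃ (e : E) (γ : Path e₀ e), ∀ t, p (γ t) = α t := by
  obtain ⟨γ, h0, hγ⟩ := hp α e₀ (by simp [h])
  exact ⟨γ 1, ⟨γ, h0, rfl⟩, fun t => DFunLike.congr_fun hγ t⟩

theorem HasUniqueLifting.eq_of_comp_eq (hp : HasUniqueLifting p) {Y : Type u} [TopologicalSpace Y]
    [ConnectedSpace Y] [LocallyPathConnectedSpace Y] {f g : C(Y, E)} (hfg : p.comp f = p.comp g)
    {y : Y} (hy : f y = g y) : f = g :=
  (hp Y y (p.comp g) _ (g y) rfl rfl (imageSubgroup_comp_le rfl rfl rfl)).unique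
    ⟨hy, hfg⟩ ⟨rfl, rfl⟩

instance : ContractibleSpace (ULift.{u} I) :=
  have : ContractibleSpace I := (convex_Icc (0 : ℝ) 1).contractibleSpace ⟨0, by simp⟩
  Homeomorph.ulift.contractibleSpace

instance : LocallyPathConnectedSpace I := (convex_Icc (0 : ℝ) 1).locallyPathConnectedSpace

instance : LocallyPathConnectedSpace (ULift.{u} I) :=
  Homeomorph.ulift.isOpenEmbedding.locallyPathConnectedSpace

theorem HasUniqueLifting.hasUniquePathLifting (hp : HasUniqueLifting p) :
    HasUniquePathLifting p := by
  intro α β h h0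
  -- `HasUniqueLifting` tests only spaces in universe `u`, so the interval is lifted there.
  let d : C(ULift.{u} I, I) := ⟨ULift.down, continuous_uliftDown⟩
  have : α.comp d = β.comp d :=
    hp.eq_of_comp_eq (by simp only [← ContinuousMap.comp_assoc, h]) (y := ⟨0⟩) h0
  ext t
  exact DFunLike.congr_fun this ⟨t⟩

theorem HasUniqueLifting.hasPathLifting (hp : HasUniqueLifting p) : HasPathLifting p := by
  intro α e he
  let d : C(ULift.{u} I, I) := ⟨ULift.down, continuous_uliftDown⟩
  obtain ⟨f, ⟨hf0, hf⟩, -⟩ := hp (ULift.{u} I) ⟨0⟩ (α.comp d) (α 0) e rfl he (by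
    intro g hg
    obtain ⟨γ, β, hβ, rfl⟩ := mem_imageSubgroup.1 hg
    obtain ⟨F⟩ := SimplyConnectedSpace.paths_homotopic γ (Path.refl _)
    have : β.Homotopic (Path.refl _) := by
      have h1 : β = γ.map (α.comp d).continuous := by ext t; exact hβ t
      rw [h1]
      exact ⟨F.map (α.comp d)⟩
    rw [Path.Homotopic.Quotient.eq.2 this]
    exact Subgroup.one_mem _)
  exact ⟨f.comp ⟨ULift.up, continuous_uliftUp⟩, hf0, by
    ext t; exact DFunLike.congr_fun hf ⟨t⟩⟩

theorem IsFibration.hasPathLifting (hp : IsFibration p) : HasPathLifting p := by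
  intro α e he
  obtain ⟨F, hF0, hF⟩ := hp PUnit (.const _ e) ⟨fun y => α y.2, by fun_prop⟩ (fun _ => he.symm)
  exact ⟨⟨fun t => F (⟨⟩, t), by fun_prop⟩, hF0 ⟨⟩, by
    ext t; exact DFunLike.congr_fun hF (⟨⟩, t)⟩

theorem _root_.IsCoveringMap.hasPathLifting (hp : IsCoveringMap p) : HasPathLifting p := by
  intro α e he
  exact ⟨hp.liftPath α e he.symm, hp.liftPath_zero .., by
    ext t; exact congr_fun (hp.liftPath_lifts α e he.symm) t⟩

end Lifting

/-! ### Local sections and the sheets they sweep out -/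

section Sections

variable {E X : Type u} [TopologicalSpace E] [TopologicalSpace X] {p : C(E, X)} {V : Set X}

/-- Every loop of `X` at `p e` inside `V` represents an element of the image of `π₁(E, e)`. -/
def LoopsLiftAt (p : C(E, X)) (V : Set X) (e : E) : Prop :=
  ∀ β : Path (p e) (p e), Set.range β ⊆ V →
    FundamentalGroup.fromPath (Path.Homotopic.Quotient.mk β) ∈ imageSubgroup p (rfl : p e = p e)

theorem LoopsLiftAt.mono {W : Set X} {e : E} (h : LoopsLiftAt p W e) (hVW : V ⊆ W) :
    LoopsLiftAt p V e := fun β hβ => h β (hβ.trans hVW)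

variable [LocallyPathConnectedSpace X]

theorem HasUniqueLifting.exists_section (hp : HasUniqueLifting p) (hV : IsOpen V)
    (hVc : IsPathConnected V) {e : E} (he : p e ∈ V) (hl : LoopsLiftAt p V e) :
    ∃ s : C(V, E), s ⟨p e, he⟩ = e ∧ ∀ v, p (s v) = v := by
  have := isPathConnected_iff_pathConnectedSpace.1 hVc
  have := hV.locallyPathConnectedSpace
  obtain ⟨s, ⟨hs, hps⟩, -⟩ := hp V ⟨p e, he⟩ ⟨Subtype.val, continuous_subtype_val⟩ (p e) e rfl rfl
    (by
      intro g hg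
      obtain ⟨γ, β, hβ, rfl⟩ := mem_imageSubgroup.1 hg
      refine hl β ?_
      rintro _ ⟨t, rfl⟩
      rw [hβ]
      exact (γ t).2)
  exact ⟨s, hs, fun v => DFunLike.congr_fun hps v⟩

theorem HasUniqueLifting.section_eq (hp : HasUniqueLifting p) (hV : IsOpen V)
    (hVc : IsPathConnected V) {s s' : C(V, E)} (hs : ∀ v, p (s v) = v) (hs' : ∀ v, p (s' v) = v)
    {v : V} (hv : s v = s' v) : s = s' := by
  have := isPathConnected_iff_pathConnectedSpace.1 hVc
  have := hV.locallyPathConnectedSpace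
  exact hp.eq_of_comp_eq (by ext v; exact (hs v).trans (hs' v).symm) hv

omit [LocallyPathConnectedSpace X] in
-- A path `γ` in `p ⁻¹' V` from `s v` has the same start and projection as `s ∘ p ∘ γ`, hence equals
-- it. So the range contains the path component of `s v` in `p ⁻¹' V`, a neighbourhood.
theorem HasUniquePathLifting.isOpen_range_section [LocallyPathConnectedSpace E]
    (hp : HasUniquePathLifting p) (hV : IsOpen V) {s : C(V, E)} (hs : ∀ v, p (s v) = v) :
    IsOpen (Set.range s) := by
  rw [isOpen_iff_mem_nhds]
  rintro _ ⟨v, rfl⟩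
  have hmem : s v ∈ p ⁻¹' V := by simp [hs]
  refine Filter.mem_of_superset (pathComponentIn_mem_nhds
    ((hV.preimage p.continuous).mem_nhds hmem)) ?_
  rintro w ⟨γ, hγ⟩
  let δ : C(I, E) := s.comp ⟨fun t => ⟨p (γ t), hγ t⟩, by fun_prop⟩
  have hδ : (γ : C(I, E)) = δ := by
    apply hp
    · ext t
      exact (hs ⟨p (γ t), hγ t⟩).symm
    · change γ 0 = s ⟨p (γ 0), _⟩
      simp [hs]
  refine ⟨⟨p (γ 1), hγ 1⟩, ?_⟩
  exact (DFunLike.congr_fun hδ 1).symm.trans γ.target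

/-- The sheets are the ranges of the sections through the points of the fibre over `x`. Sections
that agree at one point coincide, so the sheets are disjoint and each meets the fibre once. -/
theorem HasUniqueLifting.isEvenlyCovered [LocallyPathConnectedSpace E] (hp : HasUniqueLifting p)
    (hV : IsOpen V) (hVc : IsPathConnected V) {x : X} (hx : x ∈ V)
    (hl : ∀ e, p e ∈ V → LoopsLiftAt p V e) : IsEvenlyCovered p x (p ⁻¹' {x}) := by
  choose s hs hps using fun (e : E) (he : p e ∈ V) => hp.exists_section hV hVc he (hl e he)
  have hF : ∀ e : p ⁻¹' {x}, p e ∈ V := fun e => by rw [show p e = x from e.2]; exact hx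
  have hsx : ∀ e : p ⁻¹' {x}, s e (hF e) ⟨x, hx⟩ = e := fun e => by
    have hex : p e = x := e.2
    have := hs e (hF e)
    simpa only [hex] using this
  have hopen : ∀ e : p ⁻¹' {x}, IsOpen (Set.range (s e (hF e))) := fun e =>
    hp.hasUniquePathLifting.isOpen_range_section hV (hps e _)
  have hinj : ∀ (e e' : p ⁻¹' {x}) (v v' : V), s e (hF e) v = s e' (hF e') v' →
      v = v' ∧ e = e' := by
    intro e e' v v' h
    have hv : v = v' := Subtype.ext (by rw [← hps e (hF e) v, h, hps])
    subst hv
    have := hp.section_eq hV hVc (hps e _) (hps e' _) h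
    exact ⟨rfl, Subtype.ext (by rw [← hsx e, this, hsx])⟩
  have hdisc : DiscreteTopology (p ⁻¹' {x}) := by
    refine discreteTopology_iff_isOpen_singleton.2 fun e => ?_
    convert! (hopen e).preimage continuous_subtype_val
    ext e'
    constructor
    · rintro rfl
      exact ⟨_, hsx _⟩
    · rintro ⟨v, hv⟩
      have hv' : v = ⟨x, hx⟩ := Subtype.ext (by rw [← hps e (hF e) v, hv]; exact e'.2)
      rw [hv', hsx] at hv
      exact Subtype.ext hv.symm
  let Φ : V × (p ⁻¹' {x}) → p ⁻¹' V := fun q =>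
    ⟨s q.2 (hF q.2) q.1, by rw [Set.mem_preimage, hps]; exact q.1.2⟩
  have hΦ : Function.Bijective Φ := by
    constructor
    · rintro ⟨v, e⟩ ⟨v', e'⟩ h
      obtain ⟨rfl, rfl⟩ := hinj e e' v v' (congrArg Subtype.val h)
      rfl
    · rintro ⟨e', he'⟩
      -- The sheet through `e'` is labelled by the value at `x` of the section through `e'`.
      let e : p ⁻¹' {x} := ⟨s e' he' ⟨x, hx⟩, hps ..⟩
      refine ⟨(⟨p e', he'⟩, e), Subtype.ext ?_⟩
      have : s e (hF e) = s e' he' :=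
        hp.section_eq hV hVc (hps _ _) (hps _ _) (v := ⟨x, hx⟩) (hsx e)
      change s e (hF e) _ = e'
      rw [this, hs]
  have hc : Continuous Φ := by
    refine continuous_prod_of_discrete_right.2 fun e => ?_
    exact Continuous.subtype_mk (s e (hF e)).continuous _
  let Ψ := Equiv.ofBijective Φ hΦ
  have hfst : ∀ a, ((Ψ.symm a).1 : X) = p a := fun a => by
    obtain ⟨q, rfl⟩ := Ψ.surjective a
    rw [Ψ.symm_apply_apply]
    exact (hps _ _ _).symm
  refine ⟨hdisc, V, hx, hV, hV.preimage p.continuous,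
    { toEquiv := Ψ.symm
      continuous_toFun := ?_
      continuous_invFun := hc }, hfst⟩
  -- The first coordinate of the inverse is `p`; the second is locally constant, its fibres being
  -- the open sheets.
  refine Continuous.prodMk (f := fun a => (Ψ.symm a).1) (g := fun a => (Ψ.symm a).2) ?_ ?_
  · refine continuous_induced_rng.2 ?_
    have : Continuous fun a : p ⁻¹' V => p a := by fun_prop
    exact this.congr fun a => (hfst a).symm
  · refine continuous_discrete_rng.2 fun e => ?_
    convert! (hopen e).preimage continuous_subtype_val
    ext a
    obtain ⟨⟨v, e'⟩, rfl⟩ := Ψ.surjective a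
    simp only [Set.mem_preimage, Ψ.symm_apply_apply, Set.mem_singleton_iff]
    constructor
    · rintro rfl
      exact ⟨v, rfl⟩
    · rintro ⟨v', hv'⟩
      exact (hinj _ _ _ _ hv').2.symm

theorem HasUniqueLifting.isLocalHomeomorph [LocallyPathConnectedSpace E] (hp : HasUniqueLifting p)
    (hl : ∀ e, ∃ V : Set X, IsOpen V ∧ p e ∈ V ∧ LoopsLiftAt p V e) : IsLocalHomeomorph p := by
  refine isLocalHomeomorph_iff_isOpenEmbedding_restrict.2 fun e => ?_
  obtain ⟨U, hU, heU, hlU⟩ := hl e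
  set V := pathComponentIn U (p e)
  have hV : IsOpen V := hU.pathComponentIn _
  have heV : p e ∈ V := mem_pathComponentIn_self heU
  obtain ⟨s, hs, hps⟩ := hp.exists_section hV (isPathConnected_pathComponentIn heU) heV
    (hlU.mono pathComponentIn_subset)
  have hopen := hp.hasUniquePathLifting.isOpen_range_section hV hps
  refine ⟨Set.range s, hopen.mem_nhds ⟨_, hs⟩, ?_⟩
  let φ : Set.range s ≃ₜ V :=
    { toFun a := ⟨p a, by obtain ⟨_, v, rfl⟩ := a; rw [hps]; exact v.2⟩
      invFun v := ⟨s v, v, rfl⟩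
      left_inv := by rintro ⟨_, v, rfl⟩; simp [hps]
      right_inv v := Subtype.ext (hps v)
      continuous_toFun := by fun_prop
      continuous_invFun := by fun_prop }
  exact hV.isOpenEmbedding_subtypeVal.comp φ.isOpenEmbedding

end Sections

/-! ### The four comparisons -/

section Main

variable {E X : Type u} [TopologicalSpace E] [TopologicalSpace X] {p : C(E, X)} {e₀ : E} {x₀ : X}

theorem IsCovering.isPi1CoveringMap (hp : IsCovering p) (h : p e₀ = x₀) :
    IsPi1CoveringMap p h (spanierTopology x₀) := by
  have hpl := hp.isCoveringMap.hasPathLifting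
  refine ⟨hp.pathConnected, hpl, ?_⟩
  let 𝒰 : Set (Set X) := {U | IsOpen U ∧ ∀ e, p e ∈ U →
    ∃ s : C(U, E), (∀ he : p e ∈ U, s ⟨p e, he⟩ = e) ∧ ∀ v, p (s v) = v}
  have h𝒰 : IsOpenCover 𝒰 := by
    refine ⟨fun U hU => hU.1, Set.eq_univ_of_forall fun x => ?_⟩
    obtain ⟨_, U, hxU, hU, _, H, hH⟩ := hp.isCoveringMap x
    -- The section through `e` keeps the sheet coordinate of `e` constant.
    refine ⟨U, ⟨hU, fun e he => ⟨⟨fun v => H.symm (v, (H ⟨e, he⟩).2), by fun_prop⟩, ?_, ?_⟩⟩, hxU⟩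
    · intro he
      have : (⟨p e, he⟩, (H ⟨e, he⟩).2) = H ⟨e, he⟩ := 
        Prod.ext (Subtype.ext (hH ⟨e, he⟩).symm) rfl
      simp [this]
    · intro v
      change p (H.symm (v, (H ⟨e, he⟩).2)) = v
      rw [← hH, H.apply_symm_apply]
  set S : Set (FundamentalGroup X x₀) := {g | ∃ (y : X) (α : Path x₀ y) (β : Path y y),
    ∃ U ∈ 𝒰, Set.range β ⊆ U ∧ g = lollipop α β}
  refine isOpen_of_le_subgroupTopology ⟨𝒰, h𝒰, rfl⟩ ?_
  -- Conjugating a lollipop only lengthens its stem by a loop `δ` at `x₀`, so the normal closure is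
  -- the plain closure. By the reversed product, `δ` represents `c⁻¹`.
  have hconj : Group.conjugatesOfSet S ⊆ S := by
    intro g hg
    obtain ⟨_, ⟨y, α, β, U, hU, hβ, rfl⟩, hc⟩ := Group.mem_conjugatesOfSet_iff.1 hg
    obtain ⟨c, rfl⟩ := isConj_iff.1 hc
    obtain ⟨δ, hδ⟩ := Path.Homotopic.Quotient.mk_surjective (FundamentalGroup.toPath c⁻¹)
    refine ⟨y, δ.trans α, β, U, hU, hβ, ?_⟩
    have hc' : FundamentalGroup.toPath c = (Path.Homotopic.Quotient.mk δ).symm := by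
      rw [hδ]
      exact (inv_inv c).symm
    change Path.Homotopic.Quotient.trans (FundamentalGroup.toPath c⁻¹)
      (Path.Homotopic.Quotient.trans (Path.Homotopic.Quotient.mk ((α.trans β).trans α.symm))
        (FundamentalGroup.toPath c)) = Path.Homotopic.Quotient.mk _
    rw [← hδ, hc']
    simp only [Path.trans_symm, Path.Homotopic.Quotient.mk_trans, Path.Homotopic.Quotient.mk_symm,
      Path.Homotopic.Quotient.trans_assoc]
  refine (Subgroup.closure_le _).2 (hconj.trans ?_)
  rintro _ ⟨y, α, β, U, hU, hβ, rfl⟩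
  obtain ⟨e, γ, hγ⟩ := hpl.exists_path h α
  have hey : p e = y := by simpa using hγ 1
  subst hey
  have hβU : ∀ t, β t ∈ U := fun t => hβ ⟨t, rfl⟩
  have heU : p e ∈ U := β.source ▸ hβU 0
  obtain ⟨s, hs, hps⟩ := hU.2 e heU
  refine lollipop_mem_imageSubgroup h γ
    { toFun := fun t => s ⟨β t, hβU t⟩
      continuous_toFun := by fun_prop
      source' := by simp [hs]
      target' := by simp [hs] } (fun t => (hγ t).symm) fun t =>
      (hps ⟨β t, hβU t⟩).symm

theorem IsSemicovering.isPi1CoveringMap (hp : IsSemicovering p) (h : p e₀ = x₀) :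
    IsPi1CoveringMap p h (pathSpanierTopology x₀) := by
  refine ⟨hp.pathConnected, hp.pathLifting, ?_⟩
  choose e γ hγ using fun (y : X) (α : Path x₀ y) => hp.pathLifting.exists_path h α
  choose φ hφ hpφ using hp.isLocalHomeomorph
  have hey : ∀ y α, p (e y α) = y := fun y α => by simpa using hγ y α 1
  refine isOpen_of_le_subgroupTopology ⟨fun y α => (φ (e y α)).target, fun y α =>
    ⟨(φ (e y α)).open_target, ?_⟩, rfl⟩ ?_
  · have := (φ (e y α)).map_source (hφ (e y α))
    rwa [← hpφ, hey] at this
  · refine (Subgroup.closure_le _).2 ?_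
    rintro _ ⟨y, α, β, hβ, rfl⟩
    have hs : (φ (e y α)).symm y = e y α := by
      have := (φ (e y α)).left_inv (hφ (e y α))
      rwa [← hpφ, hey] at this
    refine lollipop_mem_imageSubgroup h (γ y α)
      { toFun := fun t => (φ (e y α)).symm (β t)
        continuous_toFun := (φ (e y α)).continuousOn_symm.comp_continuous β.continuous
          fun t => hβ ⟨t, rfl⟩
        source' := by simp [hs]
        target' := by simp [hs] } (fun t => (hγ y α t).symm) fun t => ?_
    change β t = p ((φ (e y α)).symm (β t))
    have := (φ (e y α)).right_inv (hβ ⟨t, rfl⟩)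
    rw [← hpφ] at this
    exact this.symm

theorem IsPi1CoveringMap.isCovering [LocallyPathConnectedSpace X] [LocallyPathConnectedSpace E]
    {h : p e₀ = x₀} (hp : IsPi1CoveringMap p h (spanierTopology x₀)) (hul : HasUniqueLifting p) :
    IsCovering p := by
  refine ⟨hp.pathConnected, fun x => ?_⟩
  have := hp.pathConnected
  obtain ⟨𝒰, h𝒰, hle⟩ := exists_spanierSubgroup_le hp.isOpen_image
  obtain ⟨U, hU, hxU⟩ := h𝒰.2.symm ▸ Set.mem_univ x
  refine hul.isEvenlyCovered ((h𝒰.1 U hU).pathComponentIn x) (isPathConnected_pathComponentIn hxU)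
    (mem_pathComponentIn_self hxU) fun e _ => LoopsLiftAt.mono (W := U) ?_ pathComponentIn_subset
  intro β hβ
  let γ := PathConnectedSpace.somePath e₀ e
  refine mk_mem_imageSubgroup_of_lollipop_mem rfl γ
    (α := (γ.map p.continuous).cast h.symm rfl) (h := h) (fun t => rfl) (hle ?_)
  exact Subgroup.subset_normalClosure ⟨_, _, _, U, hU, hβ, rfl⟩

theorem IsPi1CoveringMap.isSemicovering [LocallyPathConnectedSpace X]
    [LocallyPathConnectedSpace E] {h : p e₀ = x₀}
    (hp : IsPi1CoveringMap p h (pathSpanierTopology x₀)) (hul : HasUniqueLifting p) :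
    IsSemicovering p := by
  refine ⟨hp.pathConnected, ?_, hp.pathLifting, hul.hasUniquePathLifting⟩
  have := hp.pathConnected
  obtain ⟨V, hV, hle⟩ := exists_pathSpanierSubgroup_le hp.isOpen_image
  refine hul.isLocalHomeomorph fun e => ?_
  -- Projecting a path of `E` yields an `α` with a lift ending exactly at `e`.
  let γ := PathConnectedSpace.somePath e₀ e
  let α : Path x₀ (p e) := (γ.map p.continuous).cast h.symm rfl
  refine ⟨V _ α, (hV _ α).1, (hV _ α).2, fun β hβ => ?_⟩
  refine mk_mem_imageSubgroup_of_lollipop_mem rfl γ (α := α) (h := h) (fun t => rfl) (hle ?_)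
  exact Subgroup.subset_closure ⟨_, _, _, hβ, rfl⟩

theorem IsGeneralizedCovering.isPi1CoveringMap (hp : IsGeneralizedCovering p) (h : p e₀ = x₀) :
    IsPi1CoveringMap p h (gcovTopology x₀) :=
  ⟨hp.pathConnected, hp.uniqueLifting.hasPathLifting,
    isOpen_of_le_subgroupTopology ⟨E, _, p, e₀, h, hp, rfl⟩ le_rfl⟩

theorem fibSubgroup_le (hp : IsFibration p) (h : p e₀ = x₀) :
    fibSubgroup x₀ ≤ imageSubgroup p h := by
  refine sInf_le ?_
  exact ⟨E, _, p, e₀, h, hp, rfl⟩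

theorem IsFibration.isPi1CoveringMap [PathConnectedSpace E] (hp : IsFibration p) (h : p e₀ = x₀) :
    IsPi1CoveringMap p h (overgroupTopology (fibSubgroup x₀)) :=
  ⟨inferInstance, hp.hasPathLifting,
    isOpen_of_le_subgroupTopology (S := {K | fibSubgroup x₀ ≤ K})
      (fibSubgroup_le hp h) le_rfl⟩

end Main

end Pi1Covering

theorem theorem3p7 {E X : Type u} [TopologicalSpace E] [TopologicalSpace X] [PathConnectedSpace X]
    (p : C(E, X)) (e₀ : E) (x₀ : X) (h : p e₀ = x₀) :
    ((Pi1Covering.IsCovering p →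
        Pi1Covering.IsPi1CoveringMap p h (Pi1Covering.spanierTopology x₀)) ∧
      (LocallyPathConnectedSpace X → LocallyPathConnectedSpace E →
        Pi1Covering.IsPi1CoveringMap p h (Pi1Covering.spanierTopology x₀) →
        Pi1Covering.HasUniqueLifting p → Pi1Covering.IsCovering p)) ∧
    ((Pi1Covering.IsSemicovering p →
        Pi1Covering.IsPi1CoveringMap p h (Pi1Covering.pathSpanierTopology x₀)) ∧
      (LocallyPathConnectedSpace X → LocallyPathConnectedSpace E →
        Pi1Covering.IsPi1CoveringMap p h (Pi1Covering.pathSpanierTopology x₀) →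
        Pi1Covering.HasUniqueLifting p → Pi1Covering.IsSemicovering p)) ∧
    (Pi1Covering.IsGeneralizedCovering p →
      Pi1Covering.IsPi1CoveringMap p h (Pi1Covering.gcovTopology x₀)) ∧
    (PathConnectedSpace E → Pi1Covering.IsFibration p →
      Pi1Covering.IsPi1CoveringMap p h
        (Pi1Covering.overgroupTopology (Pi1Covering.fibSubgroup x₀))) :=
  ⟨⟨fun hp => hp.isPi1CoveringMap h, fun _ _ hp hul => hp.isCovering hul⟩,
    ⟨fun hp => hp.isPi1CoveringMap h, fun _ _ hp hul => hp.isSemicovering hul⟩,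
    fun hp => hp.isPi1CoveringMap h, fun _ hp => hp.isPi1CoveringMap h⟩
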